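/- Let $B=(V,E)$ be a Bratteli diagram: finite vertex levels $V_n$ ($n\ge 0$) with $V_0=\{v_0\}$, and finite edge sets from $V_n$ to $V_{n+1}$ such that every vertex is the source of an edge and every vertex other than $v_0$ is the range of an edge. Let $X_B$ be its space of infinite paths starting at $v_0$, with the topology generated by the cylinder sets of finite paths, and call two paths tail equivalent if they agree from some level on. Let $\overline B$ be a vertex subdiagram: it consists of $v_0$, of sets of vertices $W_n\subsetneq V_n$ ($n\ge 1$), and of all edges of $B$ between these vertices, and it is itself a Bratteli diagram. Its path space $X_{\overline B}$ is regarded as a subset of $X_B$. Let $\overline\mu$ be a finite Borel measure on $X_{\overline B}$ that is invariant and ergodic for the tail equivalence relation of $\overline B$. Let $\widehat{\overline\mu}$ be its extension by invariance to the set $\widehat X_{\overline B}$ of all paths of $B$ that are tail equivalent to a path in $X_{\overline B}$: if $w\in W_n$, if $\overline e$ is a finite path in $\overline B$ from $v_0$ to $w$ and $f$ a finite path in $B$ from $v_0$ to $w$, then the set of the paths $fz$ for which $\overline e z\in X_{\overline B}$ carries the image of $\overline\mu|_{[\overline e]}$ under $\overline e z\mapsto fz$; moreover $\widehat{\overline\mu}(X_B\setminus\widehat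 X_{\overline B})=0$. Assume that $\widehat{\overline\mu}(\widehat X_{\overline B})<\infty$, and that for every $n\ge 0$, $w\in V_n$ and $v\in V_{n+1}$ there is at least one edge from $w$ to $v$. Let $\omega$ be an order on $B$, that is, a linear order on the set of the edges with range $v$, for every $v\ne v_0$. Let $X_{\max}$ and $X_{\min}$ be the sets of the paths all of whose edges are maximal, respectively minimal, and assume that $\widehat{\overline\mu}(X_{\max})=\widehat{\overline\mu}(X_{\min})=0$. Let $T=T_\omega: X_B\setminus X_{\max}\to X_B\setminus X_{\min}$ be the Vershik map: $T$ replaces the first non-maximal edge $x_k$ of $x$ by its successor, keeps the later edges, and replaces the earlier edges by minimal edges. For $x\in X_{\overline B}\setminus X_{\max}$ let $$n(x)=\min\{n\ge 1:\ T^n x \text{ is defined and } T^n x\in X_{\overline B}\setminus X_{\min}\}$$ be the first return function. Then $n(x)$ is defined for $\overline\mu$-almost every $x\in X_{\overline B}$, and the measure $\nu$ on $X_B$ obtained from $\overline\mu$ by the first return function, $$\nu(A)=\sum_{k\ge 0}\overline\mu\bigl(\{x\in X_{\overline B}:\ n(x) \text{ is defined},\ k<n(x),\ T^k x\in A\}\bigr)\qquad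 (A\subset X_B \text{ Borel}),$$ coincides with $\widehat{\overline\mu}$. -/

import Mathlib

open MeasureTheory Set
open scoped ENNReal

noncomputable section

/-- A Bratteli diagram. `V n` is the `n`-th vertex level and `E n` is the set of edges going from
level `n` to level `n + 1`, with source map `s n` and range map `r n`. -/
structure BratteliDiagram where
  V : ℕ → Type
  E : ℕ → Type
  finite_V : ∀ n, Finite (V n)
  finite_E : ∀ n, Finite (E n)
  /-- the single vertex of level zero -/
  v₀ : V 0
  eq_v₀ : ∀ v : V 0, v = v₀
  s : ∀ n, E n → V n
  r : ∀ n, E n → V (n + 1)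
  s_surj : ∀ n, Function.Surjective (s n)
  r_surj : ∀ n, Function.Surjective (r n)

namespace BratteliDiagram

variable (B : BratteliDiagram)

instance (n : ℕ) : Finite (B.E n) := B.finite_E n

instance (n : ℕ) : Finite (B.V n) := B.finite_V n

/-- The entry `f_{v,w}` of the `n`-th incidence matrix: the number of edges from the vertex `w` of
level `n` to the vertex `v` of level `n + 1`. -/
def incidence (n : ℕ) (v : B.V (n + 1)) (w : B.V n) : ℕ :=
  Nat.card {e : B.E n // B.r n e = v ∧ B.s n e = w}

/-- The path space: all infinite paths starting at `v₀`. The `n`-th edge of a path leaves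
level `n`. -/
@[ext]
structure Path where
  edge : ∀ n, B.E n
  compat : ∀ n, B.r n (edge n) = B.s (n + 1) (edge (n + 1))

/-- The edge sets are discrete. -/
instance (n : ℕ) : TopologicalSpace (B.E n) := ⊥

instance (n : ℕ) : DiscreteTopology (B.E n) := ⟨rfl⟩

instance (n : ℕ) : SecondCountableTopology (B.E n) :=
  DiscreteTopology.secondCountableTopology_of_countable

/-- The path space carries the topology induced from the product of the discrete edge sets; its
basic open sets are the cylinder sets of finite paths. -/
instance : TopologicalSpace B.Path := TopologicalSpace.induced Path.edge inferInstance

instance : SecondCountableTopology B.Path :=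
  TopologicalSpace.secondCountableTopology_induced _ _ Path.edge

/-- The path space carries its Borel sigma-algebra. -/
instance : MeasurableSpace B.Path := borel B.Path

instance : BorelSpace B.Path := ⟨rfl⟩

variable {B}

/-- The vertex of level `n` through which an infinite path goes. -/
def Path.vertex (x : B.Path) (n : ℕ) : B.V n := B.s n (x.edge n)

/-- Tail equivalence of infinite paths. -/
def TailEquiv (x y : B.Path) : Prop := ∃ n, ∀ i, n ≤ i → x.edge i = y.edge i

/-- Saturation of a set of paths with respect to tail equivalence. -/
def saturation (A : Set B.Path) : Set B.Path := {y | ∃ x ∈ A, TailEquiv x y}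

/-- Invariance of a Borel measure under the tail equivalence relation: every Borel injection whose
graph lies in the relation preserves the measure. -/
def IsTailInvariant (μ : Measure B.Path) : Prop :=
  ∀ (A : Set B.Path) (g : B.Path → B.Path), MeasurableSet A → Measurable g → InjOn g A →
    (∀ x ∈ A, TailEquiv x (g x)) → μ (g '' A) = μ A

/-- A tail invariant measure is ergodic if each Borel set that is saturated for tail equivalence is
null or has null complement. -/
structure IsErgodic (μ : Measure B.Path) : Prop where
  invariant : IsTailInvariant μ
  null_or_conull : ∀ A : Set B.Path, MeasurableSet A → saturation A = A → μ A = 0 ∨ μ Aᶜ = 0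

variable (B)

/-- Finite paths of length `n` starting at `v₀`. -/
@[ext]
structure FinPath (n : ℕ) where
  edge : ∀ i : Fin n, B.E i
  compat : ∀ (i : ℕ) (h : i + 1 < n),
    B.r i (edge ⟨i, by omega⟩) = B.s (i + 1) (edge ⟨i + 1, h⟩)

variable {B}

/-- The final vertex of a finite path. -/
def FinPath.range : ∀ {n : ℕ}, B.FinPath n → B.V n
  | 0, _ => B.v₀
  | n + 1, f => B.r n (f.edge (Fin.last n))

/-- The cylinder set of a finite path. -/
def FinPath.cylinder {n : ℕ} (f : B.FinPath n) : Set B.Path :=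
  {x | ∀ i : Fin n, x.edge i = f.edge i}

/-- Appending an edge to a finite path. -/
def FinPath.snoc {n : ℕ} (f : B.FinPath n) (e : B.E n) (h : f.range = B.s n e) :
    B.FinPath (n + 1) :=
  ⟨fun i => if hi : (i : ℕ) < n then f.edge ⟨i, hi⟩ else
      (show n = (i : ℕ) by omega) ▸ e, by
    intro i hi
    by_cases h1 : i + 1 < n
    · have h0 : i < n := by omega
      simp only [h0, h1, dite_true]
      exact f.compat i h1
    · obtain rfl : n = i + 1 := by omega
      have h0 : i < i + 1 := by omega
      simp only [h0, dite_true, lt_irrefl, dite_false]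
      exact h⟩

theorem FinPath.snoc_range {n : ℕ} (f : B.FinPath n) (e : B.E n) (h : f.range = B.s n e) :
    (f.snoc e h).range = B.r n e := by
  simp [FinPath.range, FinPath.snoc]

theorem exists_finPath : ∀ {n : ℕ} (v : B.V n), ∃ f : B.FinPath n, f.range = v
  | 0, v => ⟨⟨fun i => i.elim0, fun i h => absurd h (by omega)⟩, (B.eq_v₀ v).symm⟩
  | n + 1, v => by
    obtain ⟨e, rfl⟩ := B.r_surj n v
    obtain ⟨f, hf⟩ := exists_finPath (B.s n e)
    exact ⟨f.snoc e hf, f.snoc_range e hf⟩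

/-- A reference path from `v₀` to the vertex `v`. -/
def refPath {n : ℕ} (v : B.V n) : B.FinPath n := (exists_finPath v).choose

theorem refPath_range {n : ℕ} (v : B.V n) : (refPath v).range = v := (exists_finPath v).choose_spec

theorem splice_compat {n : ℕ} (f : B.FinPath n) (x : B.Path) (h : f.range = x.vertex n) (i : ℕ) :
    B.r i (if hi : i < n then f.edge ⟨i, hi⟩ else x.edge i) =
      B.s (i + 1) (if hi : i + 1 < n then f.edge ⟨i + 1, hi⟩ else x.edge (i + 1)) := by
  by_cases h1 : i + 1 < n
  · have h0 : i < n := by omega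
    simp only [h0, h1, dite_true]
    exact f.compat i h1
  · by_cases h0 : i < n
    · obtain rfl : n = i + 1 := by omega
      simp only [h0, dite_true, lt_irrefl, dite_false]
      exact h
    · simp only [h0, h1, dite_false]
      exact x.compat i

open Classical in
/-- Replacing the first `n` edges of the path `x` by a finite path `f` of length `n` that ends at
the vertex of `x` at level `n` (for other `x` the value is irrelevant and set to be `x`). -/
def splice {n : ℕ} (f : B.FinPath n) (x : B.Path) : B.Path :=
  if h : f.range = x.vertex n then
    ⟨fun i => if hi : i < n then f.edge ⟨i, hi⟩ else x.edge i, splice_compat f x h⟩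
  else x

theorem splice_edge {n : ℕ} (f : B.FinPath n) (x : B.Path) (h : f.range = x.vertex n) (i : ℕ) :
    (splice f x).edge i = if hi : i < n then f.edge ⟨i, hi⟩ else x.edge i := by
  rw [splice, dif_pos h]

theorem continuous_edge (i : ℕ) : Continuous fun x : B.Path => x.edge i :=
  (continuous_apply i).comp (continuous_induced_dom (f := Path.edge))

theorem continuous_of_edge {X : Type*} [TopologicalSpace X] {g : X → B.Path}
    (h : ∀ i, Continuous fun x => (g x).edge i) : Continuous g :=
  continuous_induced_rng.2 (continuous_pi h)

theorem continuous_of_finite_dependence {C : BratteliDiagram} {g : B.Path → C.Path}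
    (h : ∀ i, ∃ N, ∀ x y : B.Path, (∀ j, j < N → x.edge j = y.edge j) →
      (g x).edge i = (g y).edge i) : Continuous g := by
  refine continuous_of_edge fun i => ?_
  obtain ⟨N, hN⟩ := h i
  refine (IsLocallyConstant.iff_eventually_eq _).2 (fun x => ?_) |>.continuous
  have h1 : ∀ᶠ y in nhds x, ∀ j ∈ Finset.range N, y.edge j = x.edge j := by
    rw [Filter.eventually_all_finset]
    intro j _
    exact ((continuous_edge j).continuousAt (x := x)).eventually
      (p := fun e => e = x.edge j) (by simp [nhds_discrete])
  filter_upwards [h1] with y hy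
  exact hN _ _ fun j hj => hy j (Finset.mem_range.2 hj)

theorem measurable_splice {n : ℕ} (f : B.FinPath n) : Measurable (splice f) := by
  refine (continuous_of_finite_dependence fun i => ⟨n + i + 1, fun x y hxy => ?_⟩).measurable
  have hv : x.vertex n = y.vertex n := by
    simp only [Path.vertex, hxy n (by omega)]
  by_cases h : f.range = x.vertex n
  · rw [splice_edge f x h, splice_edge f y (h.trans hv), hxy i (by omega)]
  · rw [splice, splice, dif_neg h, dif_neg (by rwa [← hv]), hxy i (by omega)]

variable (B)

/-- A vertex subdiagram, given by its supporting vertices `W n`, which form a proper subset of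
`V n` for `n ≥ 1`. The last two fields say that these vertices, together with all edges between
them, form a Bratteli diagram. -/
structure VertexSubdiagram where
  W : ∀ n, Set (B.V n)
  W_zero : W 0 = univ
  proper : ∀ n, W (n + 1) ≠ univ
  exists_s : ∀ n, ∀ v ∈ W n, ∃ e : B.E n, B.s n e = v ∧ B.r n e ∈ W (n + 1)
  exists_r : ∀ n, ∀ v ∈ W (n + 1), ∃ e : B.E n, B.r n e = v ∧ B.s n e ∈ W n

variable {B}

namespace VertexSubdiagram

variable (S : B.VertexSubdiagram)

/-- The Bratteli diagram formed by the vertices in `W n` and all edges of `B` between them. -/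
def diagram : BratteliDiagram where
  V n := {v : B.V n // v ∈ S.W n}
  E n := {e : B.E n // B.s n e ∈ S.W n ∧ B.r n e ∈ S.W (n + 1)}
  finite_V _ := inferInstance
  finite_E _ := inferInstance
  v₀ := ⟨B.v₀, by rw [S.W_zero]; trivial⟩
  eq_v₀ v := Subtype.ext (B.eq_v₀ v.1)
  s _ e := ⟨B.s _ e.1, e.2.1⟩
  r _ e := ⟨B.r _ e.1, e.2.2⟩
  s_surj n v := by
    obtain ⟨e, he, hr⟩ := S.exists_s n v.1 v.2
    exact ⟨⟨e, by rw [he]; exact v.2, hr⟩, Subtype.ext he⟩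
  r_surj n v := by
    obtain ⟨e, he, hs⟩ := S.exists_r n v.1 v.2
    exact ⟨⟨e, hs, by rw [he]; exact v.2⟩, Subtype.ext he⟩

/-- A path of the subdiagram, seen as a path of the whole diagram. -/
def incl (x : S.diagram.Path) : B.Path :=
  ⟨fun n => (x.edge n).1, fun n => congrArg Subtype.val (x.compat n)⟩

theorem measurable_incl : Measurable S.incl :=
  (continuous_of_finite_dependence fun i =>
    ⟨i + 1, fun _ _ h => congrArg Subtype.val (h i (by omega))⟩).measurable

/-- The path space of the subdiagram as a subset of the path space of the whole diagram. -/
def pathSet : Set B.Path := Set.range S.incl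

/-- The paths whose tail from level `n` on belongs to the subdiagram. -/
def tailSet (n : ℕ) : Set B.Path := {x | ∀ i, n ≤ i → x.vertex i ∈ S.W i}

/-- The extension by invariance of a measure `μ` from the path space of the subdiagram to
`tailSet n`. For each vertex `w ∈ W n`, fix a path `e` in the subdiagram from `v₀` to `w`. For each
path `f` of the whole diagram from `v₀` to `w`, the cylinder set of `e` in the subdiagram, with
its measure, is copied by the map replacing `e` by `f`. -/
def extensionLevel (μ : Measure S.diagram.Path) (n : ℕ) : Measure B.Path :=
  Measure.sum fun f : {f : B.FinPath n // f.range ∈ S.W n} =>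
    (μ.restrict (FinPath.cylinder (refPath (B := S.diagram) ⟨f.1.range, f.2⟩))).map
      fun x => splice f.1 (S.incl x)

/-- The extension of a measure `μ` from the path space of the subdiagram to the saturation of that
path space, by invariance with respect to tail equivalence. The saturation is the increasing union
of the sets `tailSet n`, and the measure is given by `extensionLevel μ n` on each
difference `tailSet n \ tailSet (n - 1)`; it vanishes outside the saturation. -/
def extension (μ : Measure S.diagram.Path) : Measure B.Path :=
  Measure.sum fun n =>
    (S.extensionLevel μ n).restrict (S.tailSet n \ ⋃ m, ⋃ _ : m < n, S.tailSet m)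

end VertexSubdiagram

variable (B)

/-- An order on a Bratteli diagram: a partial order on the edges such that two edges are comparable
if and only if they have the same range. -/
structure EdgeOrder where
  le : ∀ n, B.E n → B.E n → Prop
  refl : ∀ n e, le n e e
  antisymm : ∀ n e f, le n e f → le n f e → e = f
  trans : ∀ n e f g, le n e f → le n f g → le n e g
  comparable_iff : ∀ n e f, (le n e f ∨ le n f e) ↔ B.r n e = B.r n f

variable {B}

namespace EdgeOrder

variable (ω : B.EdgeOrder)

/-- `e` is maximal among the edges with the same range. -/
def IsMaxEdge {n : ℕ} (e : B.E n) : Prop := ∀ f, ω.le n e f → f = e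

/-- `e` is minimal among the edges with the same range. -/
def IsMinEdge {n : ℕ} (e : B.E n) : Prop := ∀ f, ω.le n f e → f = e

/-- `f` is the immediate successor of `e`. -/
def IsSucc {n : ℕ} (e f : B.E n) : Prop :=
  (ω.le n e f ∧ e ≠ f) ∧ ∀ g, ω.le n e g ∧ e ≠ g → ω.le n f g

/-- The set of maximal paths. -/
def maxPaths : Set B.Path := {x | ∀ n, ω.IsMaxEdge (x.edge n)}

/-- The set of minimal paths. -/
def minPaths : Set B.Path := {x | ∀ n, ω.IsMinEdge (x.edge n)}

/-- The relation `y = T x` for the Vershik map `T`: with `k` the least index such that the edge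
`x_k` is not maximal, `x_k` is replaced by its successor, the edges after it are kept, and the
edges before it are replaced by minimal edges. -/
def VershikRel (x y : B.Path) : Prop :=
  ∃ k, (∀ i < k, ω.IsMaxEdge (x.edge i)) ∧ ¬ ω.IsMaxEdge (x.edge k) ∧
    (∀ i < k, ω.IsMinEdge (y.edge i)) ∧ ω.IsSucc (x.edge k) (y.edge k) ∧
    ∀ i > k, y.edge i = x.edge i

theorem le_range {n : ℕ} {e f : B.E n} (h : ω.le n e f) : B.r n e = B.r n f :=
  (ω.comparable_iff n e f).1 (Or.inl h)

theorem exists_least {n : ℕ} (A : Set (B.E n)) (hA : A.Nonempty)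
    (hr : ∀ e ∈ A, ∀ f ∈ A, B.r n e = B.r n f) : ∃ e ∈ A, ∀ f ∈ A, ω.le n e f := by
  have : IsTrans (B.E n) fun e f => ω.le n e f ∧ e ≠ f :=
    ⟨fun a b c hab hbc => ⟨ω.trans _ _ _ _ hab.1 hbc.1, by
      rintro rfl
      exact hab.2 (ω.antisymm _ _ _ hab.1 hbc.1)⟩⟩
  have : Std.Irrefl fun e f : B.E n => ω.le n e f ∧ e ≠ f := ⟨fun a h => h.2 rfl⟩
  have wf : WellFounded fun e f : B.E n => ω.le n e f ∧ e ≠ f :=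
    Finite.wellFounded_of_trans_of_irrefl _
  obtain ⟨e, he, hmin⟩ := wf.has_min A hA
  refine ⟨e, he, fun f hf => ?_⟩
  rcases (ω.comparable_iff n e f).2 (hr e he f hf) with h | h
  · exact h
  · by_cases hfe : f = e
    · exact hfe ▸ ω.refl n f
    · exact absurd ⟨h, hfe⟩ (hmin f hf)

theorem exists_minFinPath : ∀ {n : ℕ} (v : B.V n),
    ∃ f : B.FinPath n, f.range = v ∧ ∀ i, ω.IsMinEdge (f.edge i)
  | 0, v => ⟨⟨fun i => i.elim0, fun i h => absurd h (by omega)⟩, (B.eq_v₀ v).symm,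
      fun i => i.elim0⟩
  | n + 1, v => by
    obtain ⟨e, he, hmin⟩ := ω.exists_least {e : B.E n | B.r n e = v} (B.r_surj n v)
      (fun e he f hf => Eq.trans he (Eq.symm hf))
    obtain ⟨f, hf, hfm⟩ := exists_minFinPath (B.s n e)
    refine ⟨f.snoc e hf, (f.snoc_range e hf).trans he, fun i => ?_⟩
    refine Fin.lastCases ?_ (fun j => ?_) i
    · have : (f.snoc e hf).edge (Fin.last n) = e := by simp [FinPath.snoc]
      rw [this]
      intro g hg
      exact ω.antisymm _ _ _ hg (hmin g ((ω.le_range hg).trans he))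
    · have : (f.snoc e hf).edge j.castSucc = f.edge j := by simp [FinPath.snoc]
      rw [this]
      exact hfm j

theorem exists_vershikRel {x : B.Path} (hx : x ∉ ω.maxPaths) : ∃ y, ω.VershikRel x y := by
  classical
  have hx' : ∃ n, ¬ ω.IsMaxEdge (x.edge n) := by simpa [maxPaths] using hx
  let k := Nat.find hx'
  have hk : ¬ ω.IsMaxEdge (x.edge k) := Nat.find_spec hx'
  have hlt : ∀ i < k, ω.IsMaxEdge (x.edge i) := fun i hi => not_not.1 (Nat.find_min hx' hi)
  obtain ⟨e, he, hleast⟩ := ω.exists_least {g : B.E k | ω.le k (x.edge k) g ∧ x.edge k ≠ g} (by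
      simp only [IsMaxEdge, not_forall] at hk
      obtain ⟨g, hg, hne⟩ := hk
      exact ⟨g, hg, Ne.symm hne⟩)
    (fun a ha b hb => (ω.le_range ha.1).symm.trans (ω.le_range hb.1))
  obtain ⟨f, hf, hfm⟩ := ω.exists_minFinPath (B.s k e)
  have hlast : (f.snoc e hf).edge (Fin.last k) = e := by simp [FinPath.snoc]
  have hrange : (f.snoc e hf).range = x.vertex (k + 1) := by
    rw [f.snoc_range, ← ω.le_range he.1]
    exact x.compat k
  refine ⟨⟨_, splice_compat (f.snoc e hf) x hrange⟩, k, hlt, hk, fun i hi => ?_, ?_, fun i hi => ?_⟩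
  · have h1 : i < k + 1 := by omega
    have : (f.snoc e hf).edge ⟨i, h1⟩ = f.edge ⟨i, hi⟩ := by simp [FinPath.snoc, hi]
    simp only [h1, dite_true]
    rw [this]
    exact hfm _
  · have h1 : k < k + 1 := by omega
    have h2 : (f.snoc e hf).edge ⟨k, h1⟩ = e := hlast
    simp only [h1, dite_true]
    rw [h2]
    exact ⟨he, hleast⟩
  · have h1 : ¬ i < k + 1 := by omega
    simp only [h1, dite_false]

open Classical in
/-- The Vershik map `T`, a map from the complement of the maximal paths to the complement of the
minimal paths. It is defined outside the set of maximal paths; a maximal path is assigned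
itself as a placeholder value, which is never used below. -/
def vershik (x : B.Path) : B.Path :=
  if h : x ∈ ω.maxPaths then x else (ω.exists_vershikRel h).choose

theorem vershik_spec {x : B.Path} (hx : x ∉ ω.maxPaths) : ω.VershikRel x (ω.vershik x) := by
  rw [vershik, dif_neg hx]
  exact (ω.exists_vershikRel hx).choose_spec

theorem vershikRel_edge_eq {x x' y y' : B.Path} (h : ω.VershikRel x y) (h' : ω.VershikRel x' y')
    {k : ℕ} (hk : ¬ ω.IsMaxEdge (x.edge k)) {i : ℕ} (hx : ∀ j ≤ i + k + 1, x.edge j = x'.edge j) :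
    y.edge i = y'.edge i := by
  obtain ⟨m, hm1, hm2, hm3, hm4, hm5⟩ := h
  obtain ⟨m', hm1', hm2', hm3', hm4', hm5'⟩ := h'
  have hmk : m ≤ k := by
    by_contra hc
    exact hk (hm1 k (by omega))
  have hmm : m = m' := by
    rcases lt_trichotomy m m' with hlt | heq | hgt
    · exact absurd (hx m (by omega) ▸ hm1' m hlt) hm2
    · exact heq
    · exact absurd (hx m' (by omega) ▸ hm1 m' hgt) hm2'
  subst hmm
  have main : ∀ d, d ≤ m → y.edge (m - d) = y'.edge (m - d) := by
    intro d
    induction d with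
    | zero =>
      intro _
      simp only [Nat.sub_zero]
      rw [hx m (by omega)] at hm4
      exact ω.antisymm _ _ _ (hm4.2 _ hm4'.1) (hm4'.2 _ hm4.1)
    | succ d ih =>
      intro hd
      have h1 := ih (by omega)
      obtain ⟨p, hp⟩ : ∃ p, p = m - (d + 1) := ⟨_, rfl⟩
      have hp1 : m - d = p + 1 := by omega
      rw [hp1] at h1
      rw [← hp]
      have hr : B.r p (y.edge p) = B.r p (y'.edge p) := by
        rw [y.compat p, y'.compat p, h1]
      rcases (ω.comparable_iff p _ _).2 hr with h2 | h2
      · exact hm3' p (by omega) _ h2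
      · exact (hm3 p (by omega) _ h2).symm
  by_cases him : i ≤ m
  · have := main (m - i) (by omega)
    rwa [show m - (m - i) = i by omega] at this
  · rw [hm5 i (by omega), hm5' i (by omega), hx i (by omega)]

theorem isClosed_maxPaths : IsClosed ω.maxPaths := by
  have : ω.maxPaths = ⋂ n, (fun x : B.Path => x.edge n) ⁻¹' {e | ω.IsMaxEdge e} := by
    ext x
    simp [maxPaths]
  rw [this]
  exact isClosed_iInter fun n => (isClosed_discrete _).preimage (continuous_edge n)

theorem measurable_vershik : Measurable ω.vershik := by
  refine measurable_of_isOpen fun U hU => ?_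
  have hsplit : ω.vershik ⁻¹' U = (ω.maxPaths ∩ U) ∪ (ω.maxPathsᶜ ∩ ω.vershik ⁻¹' U) := by
    ext x
    by_cases hx : x ∈ ω.maxPaths
    · simp [hx, vershik]
    · simp [hx]
  have hcont : ContinuousOn ω.vershik ω.maxPathsᶜ := by
    rw [continuousOn_iff_continuous_domRestrict]
    refine continuous_of_edge fun i => ?_
    refine (IsLocallyConstant.iff_eventually_eq _).2 (fun x => ?_) |>.continuous
    obtain ⟨k, hk⟩ : ∃ k, ¬ ω.IsMaxEdge (x.1.edge k) := by
      simpa [maxPaths] using x.2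
    have h1 : ∀ᶠ y in nhds x, ∀ j ∈ Finset.range (i + k + 2), y.1.edge j = x.1.edge j := by
      rw [Filter.eventually_all_finset]
      intro j _
      exact (((continuous_edge j).comp continuous_subtype_val).continuousAt (x := x)).eventually
        (p := fun e => e = x.1.edge j) (by simp [nhds_discrete])
    filter_upwards [h1] with y hy
    exact (ω.vershikRel_edge_eq (ω.vershik_spec x.2) (ω.vershik_spec y.2) hk
      (fun j hj => (hy j (Finset.mem_range.2 (by omega))).symm)).symm
  rw [hsplit]
  exact (ω.isClosed_maxPaths.measurableSet.inter hU.measurableSet).union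
    (hcont.isOpen_inter_preimage ω.isClosed_maxPaths.isOpen_compl hU).measurableSet

/-- `n ≥ 1` is a return time of `x` to the path space of the subdiagram `S`: the point `T ^ n x`
is defined and lies in this path space (and is not a minimal path). -/
def IsReturnTime (S : B.VertexSubdiagram) (x : B.Path) (n : ℕ) : Prop :=
  1 ≤ n ∧ (∀ j < n, ω.vershik^[j] x ∉ ω.maxPaths) ∧ ω.vershik^[n] x ∈ S.pathSet \ ω.minPaths

/-- The first return function `x ↦ min {n ≥ 1 | T ^ n x ∈ pathSet}`. It has the value `0` at points
that do not return. -/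
def firstReturn (S : B.VertexSubdiagram) (x : B.Path) : ℕ := sInf {n | ω.IsReturnTime S x n}

/-- The measure on the path space of `B` obtained from a measure `μ` on the path space of the
subdiagram through the first return function: each set `T ^ k {x | k < firstReturn x}`, a floor of
the skyscraper, receives the image under `T ^ k` of the restriction of `μ`
to `{x | k < firstReturn x}`. -/
def returnMeasure (S : B.VertexSubdiagram) (μ : Measure S.diagram.Path) : Measure B.Path :=
  Measure.sum fun k : ℕ =>
    (μ.restrict {x | k < ω.firstReturn S (S.incl x)}).map fun x => ω.vershik^[k] (S.incl x)

end EdgeOrder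

end BratteliDiagram

end

/-! ### Finite paths, cylinder sets and splicing. -/

noncomputable section

namespace BratteliDiagram

variable {B : BratteliDiagram}

/-! The extension is an invariant measure of the Vershik map `T`, and a finite invariant measure is
recovered from its restriction to a set that almost every orbit visits: it is the sum of the floors
of the skyscraper over that set.

Invariance: near a non-maximal path, `T` only exchanges one finite initial segment for another with
the same range. The extension does not see such exchanges (`extension_splice`), because tail
invariance of `μ` makes it independent of the level and of the reference paths used to define it
(`extension_apply`). Countably many exchanges describe `T` outside null sets
(`measurePreserving_vershik`).

Visits: finiteness makes `T` conservative, so almost every point of the path space of the subdiagram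
returns to it infinitely often. Two tail equivalent paths lie on one orbit
(`exists_iterate_vershik_eq_or`). A path in some `tailSet` whose orbit never meets the subdiagram
therefore lies on the forward orbit of a point of the subdiagram that returns only finitely often.
Such points form a null set, and its saturation is null too (`extension_saturation_null`).

The skyscraper formula is `measure_eq_tsum_of_ae_hits`. It gives the claim because the extension
restricts to `μ` on the subdiagram (`map_incl_eq_restrict_extension`). -/

instance (n : ℕ) : Finite (B.FinPath n) :=
  Finite.of_injective FinPath.edge fun _ _ h => FinPath.ext h

/-- The initial segment of length `n` of an infinite path. -/
def Path.take (x : B.Path) (n : ℕ) : B.FinPath n :=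
  ⟨fun i => x.edge i, fun i _ => x.compat i⟩

theorem Path.mem_cylinder_take (x : B.Path) (n : ℕ) : x ∈ (x.take n).cylinder := fun _ => rfl

theorem FinPath.range_eq_vertex {n : ℕ} {f : B.FinPath n} {x : B.Path} (hx : x ∈ f.cylinder) :
    f.range = x.vertex n := by
  cases n with
  | zero => exact (B.eq_v₀ _).symm
  | succ n =>
    have h := hx (Fin.last n)
    simp only [FinPath.range, Path.vertex, ← x.compat n]
    exact congrArg (B.r n) h.symm

theorem FinPath.measurableSet_cylinder {n : ℕ} (f : B.FinPath n) : MeasurableSet f.cylinder := by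
  have : f.cylinder = ⋂ i : Fin n, (fun x : B.Path => x.edge i) ⁻¹' {f.edge i} := by
    ext x
    simp [FinPath.cylinder]
  rw [this]
  exact MeasurableSet.iInter fun i =>
    ((isClosed_discrete _).preimage (continuous_edge (i : ℕ))).measurableSet

theorem FinPath.eq_of_mem_cylinder {n : ℕ} {f g : B.FinPath n} {x : B.Path}
    (hf : x ∈ f.cylinder) (hg : x ∈ g.cylinder) : f = g :=
  FinPath.ext (funext fun i => (hf i).symm.trans (hg i))

theorem splice_edge_of_le {n : ℕ} (f : B.FinPath n) (x : B.Path) {i : ℕ} (hi : n ≤ i) :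
    (splice f x).edge i = x.edge i := by
  by_cases h : f.range = x.vertex n
  · rw [splice_edge f x h, dif_neg (by omega)]
  · rw [splice, dif_neg h]

theorem splice_mem_cylinder {n : ℕ} {f : B.FinPath n} {x : B.Path} (h : f.range = x.vertex n) :
    splice f x ∈ f.cylinder := fun i => by
  rw [splice_edge f x h, dif_pos i.2]

theorem splice_eq {n : ℕ} {f : B.FinPath n} {x y : B.Path} (hy : y ∈ f.cylinder)
    (hxy : ∀ i, n ≤ i → y.edge i = x.edge i) : splice f x = y := by
  have h : f.range = x.vertex n := by
    rw [FinPath.range_eq_vertex hy, Path.vertex, Path.vertex, hxy n le_rfl]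
  ext i
  by_cases hi : i < n
  · rw [splice_edge f x h, dif_pos hi]
    exact (hy ⟨i, hi⟩).symm
  · rw [splice_edge_of_le f x (by omega), hxy i (by omega)]

/-! ### The extension by invariance and its independence of choices. -/

namespace VertexSubdiagram

variable (S : B.VertexSubdiagram)

theorem measurableSet_tailSet (n : ℕ) : MeasurableSet (S.tailSet n) := by
  have : S.tailSet n = ⋂ i, ⋂ _ : n ≤ i, (fun x : B.Path => x.edge i) ⁻¹' (B.s i ⁻¹' S.W i) := by
    ext x
    simp [tailSet, Path.vertex]
  rw [this]
  exact MeasurableSet.iInter fun i => MeasurableSet.iInter fun _ =>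
    ((isClosed_discrete _).preimage (continuous_edge i)).measurableSet

theorem tailSet_mono : Monotone S.tailSet := fun _ _ hmn _ hx i hi => hx i (hmn.trans hi)

variable {S}

theorem mem_tailSet_of_edge_eq {n : ℕ} {x y : B.Path} (hx : x ∈ S.tailSet n)
    (hxy : ∀ i, n ≤ i → x.edge i = y.edge i) : y ∈ S.tailSet n := fun i hi => by
  have := hx i hi
  rwa [Path.vertex, hxy i hi] at this

theorem incl_mem_tailSet (x : S.diagram.Path) (n : ℕ) : S.incl x ∈ S.tailSet n :=
  fun i _ => (x.edge i).2.1

/-- A path whose tail lies in the subdiagram becomes a path of the subdiagram when its initial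
segment is replaced by a finite path of the subdiagram. -/
theorem exists_mem_cylinder {n : ℕ} {e : S.diagram.FinPath n} {y : B.Path} (hy : y ∈ S.tailSet n)
    (he : e.range = (⟨y.vertex n, hy n le_rfl⟩ : {v : B.V n // v ∈ S.W n})) :
    ∃ x ∈ e.cylinder, ∀ i, n ≤ i → (S.incl x).edge i = y.edge i := by
  -- From level `n` on, both ends of each edge of `y` lie in `W`, so the edge belongs to the
  -- subdiagram.
  obtain ⟨c, hc⟩ : ∃ c : ∀ i, ¬ i < n → S.diagram.E i, ∀ i hi, (c i hi).1 = y.edge i :=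
    ⟨fun i hi => ⟨y.edge i, hy i (by omega), by rw [y.compat]; exact hy (i + 1) (by omega)⟩,
      fun _ _ => rfl⟩
  refine ⟨⟨fun i => if hi : i < n then e.edge ⟨i, hi⟩ else c i hi, fun i => ?_⟩,
    fun i => dif_pos i.2, fun i hi => ?_⟩
  · by_cases h1 : i + 1 < n
    · have h0 : i < n := by omega
      simp only [h0, h1, dite_true]
      exact e.compat i h1
    · have hs : (S.diagram.s (i + 1) (c (i + 1) h1)).1 = y.vertex (i + 1) :=
        congrArg (B.s (i + 1)) (hc _ h1)
      by_cases h0 : i < n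
      · obtain rfl : n = i + 1 := by omega
        simp only [h0, dite_true, lt_irrefl, dite_false]
        exact he.trans (Subtype.ext hs.symm)
      · simp only [h0, h1, dite_false]
        refine Subtype.ext (Eq.trans ?_ hs.symm)
        exact (congrArg (B.r i) (hc _ h0)).trans (y.compat i)
  · have h0 : ¬ i < n := by omega
    exact (congrArg Subtype.val (dif_neg h0)).trans (hc i h0)

/-- A vertex subdiagram keeps all edges between its vertices, so membership of a path is decided by
its vertices alone. -/
theorem pathSet_eq_tailSet_zero : S.pathSet = S.tailSet 0 := by
  refine Subset.antisymm (range_subset_iff.2 fun x => incl_mem_tailSet x 0) fun y hy => ?_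
  obtain ⟨x, -, hx⟩ := exists_mem_cylinder (e := refPath (B := S.diagram)
    (⟨y.vertex 0, hy 0 le_rfl⟩ : {v : B.V 0 // v ∈ S.W 0})) hy (refPath_range (B := S.diagram) _)
  exact ⟨x, Path.ext (funext fun i => hx i i.zero_le)⟩

theorem measurableSet_pathSet : MeasurableSet S.pathSet := by
  rw [pathSet_eq_tailSet_zero]
  exact S.measurableSet_tailSet 0

theorem exists_mem_pathSet_of_mem_tailSet {n : ℕ} {y : B.Path} (hy : y ∈ S.tailSet n) :
    ∃ x ∈ S.pathSet, ∀ i, n ≤ i → x.edge i = y.edge i := by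
  obtain ⟨x, -, hx⟩ := exists_mem_cylinder (e := refPath (B := S.diagram)
    (⟨y.vertex n, hy n le_rfl⟩ : {v : B.V n // v ∈ S.W n})) hy (refPath_range (B := S.diagram) _)
  exact ⟨_, ⟨x, rfl⟩, hx⟩

theorem incl_range_eq {n : ℕ} {e : S.diagram.FinPath n} {w : {v : B.V n // v ∈ S.W n}}
    (he : e.range = w) {x : S.diagram.Path} (hx : x ∈ e.cylinder) :
    (S.incl x).vertex n = w := by
  have h := (FinPath.range_eq_vertex hx).symm.trans he
  exact congrArg Subtype.val h

theorem measurableSet_cylinder_splice {n : ℕ} (f : B.FinPath n) (e : S.diagram.FinPath n)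
    {A : Set B.Path} (hA : MeasurableSet A) :
    MeasurableSet {x | x ∈ e.cylinder ∧ splice f (S.incl x) ∈ A} :=
  e.measurableSet_cylinder.inter (((measurable_splice f).comp S.measurable_incl) hA)

variable {μ : Measure S.diagram.Path}

theorem extensionLevel_apply (m : ℕ) {C : Set B.Path} (hC : MeasurableSet C) :
    S.extensionLevel μ m C = ∑' g : {f : B.FinPath m // f.range ∈ S.W m},
      μ {x | x ∈ (refPath (B := S.diagram) (⟨g.1.range, g.2⟩ : {v : B.V m // v ∈ S.W m})).cylinder ∧
        splice g.1 (S.incl x) ∈ C} := by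
  rw [extensionLevel, Measure.sum_apply _ hC]
  refine tsum_congr fun g => ?_
  have hm : Measurable fun x => splice g.1 (S.incl x) :=
    (measurable_splice g.1).comp S.measurable_incl
  rw [Measure.map_apply hm hC, Measure.restrict_apply (hm hC), inter_comm]
  rfl

/-- Compatibility of the levels: the copy made with a reference path of length `m` agrees with the
one made with any `e` of length `n`, since `splice e` carries one preimage of `C` onto the other
within tail classes and `μ` is tail invariant. -/
theorem extensionLevel_eq (hμ : IsTailInvariant μ) {m n : ℕ} (hmn : m ≤ n) {f : B.FinPath n}
    {e : S.diagram.FinPath n} {w : {v : B.V n // v ∈ S.W n}} (he : e.range = w)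
    (hf : f.range = w) {C : Set B.Path} (hC : MeasurableSet C)
    (hCf : C ⊆ f.cylinder) (hCm : C ⊆ S.tailSet m) :
    S.extensionLevel μ m C = μ {x | x ∈ e.cylinder ∧ splice f (S.incl x) ∈ C} := by
  rcases C.eq_empty_or_nonempty with rfl | ⟨c, hc⟩
  · simp
  have hcr : (c.take m).range = c.vertex m := FinPath.range_eq_vertex (c.mem_cylinder_take m)
  -- All points of `C` share their first `m` edges, so only the summand of `g` survives.
  let g : {f : B.FinPath m // f.range ∈ S.W m} :=
    ⟨c.take m, by rw [hcr]; exact hCm hc m le_rfl⟩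
  have hg : ∀ y ∈ C, y ∈ g.1.cylinder := fun y hy i => by
    have hi : (i : ℕ) < n := i.2.trans_le hmn
    exact (hCf hy ⟨i, hi⟩).trans (hCf hc ⟨i, hi⟩).symm
  rw [extensionLevel_apply m hC, tsum_eq_single g]
  · let e' := refPath (B := S.diagram) (⟨g.1.range, g.2⟩ : {v : B.V m // v ∈ S.W m})
    have key : ∀ x : S.diagram.Path, splice g.1 (S.incl x) ∈ C →
        splice e x ∈ e.cylinder ∧
          splice f (S.incl (splice e x)) = splice g.1 (S.incl x) := by
      intro x hx
      refine ⟨splice_mem_cylinder (he.trans (Subtype.ext ?_)), splice_eq (hCf hx) fun i hi => ?_⟩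
      · rw [← hf, FinPath.range_eq_vertex (hCf hx), Path.vertex, splice_edge_of_le _ _ hmn]
        rfl
      · rw [splice_edge_of_le _ _ (hmn.trans hi)]
        exact congrArg Subtype.val (splice_edge_of_le e x hi).symm
    have himage : splice e '' {x | x ∈ e'.cylinder ∧ splice g.1 (S.incl x) ∈ C} =
        {x | x ∈ e.cylinder ∧ splice f (S.incl x) ∈ C} := by
      apply Subset.antisymm
      · rintro _ ⟨x, ⟨-, hx⟩, rfl⟩
        exact ⟨(key x hx).1, by rw [(key x hx).2]; exact hx⟩
      · rintro x ⟨hxe, hx⟩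
        have hxm := hCm hx
        obtain ⟨x', hx'e, hx'⟩ := exists_mem_cylinder (e := e') hxm
          ((refPath_range (B := S.diagram) _).trans
            (Subtype.ext (FinPath.range_eq_vertex (hg _ hx))))
        have h1 : splice g.1 (S.incl x') = splice f (S.incl x) :=
          splice_eq (hg _ hx) fun i hi => (hx' i hi).symm
        refine ⟨x', ⟨hx'e, by rw [h1]; exact hx⟩, splice_eq hxe fun i hi => Subtype.ext ?_⟩
        have h2 := hx' i (hmn.trans hi)
        rw [splice_edge_of_le _ _ hi] at h2
        exact h2.symm
    rw [← himage]
    refine (hμ _ _ (measurableSet_cylinder_splice g.1 e' hC) (measurable_splice e) ?_ ?_).symm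
    -- `splice e` overwrites the edges between levels `m` and `n`, but on this set they are
    -- prescribed by `f`; the edges below `m` are prescribed by `e'`.
    · rintro x ⟨hxe, hx⟩ y ⟨hye, hy⟩ hxy
      have h1 : splice g.1 (S.incl x) = splice g.1 (S.incl y) := by
        rw [← (key x hx).2, ← (key y hy).2, hxy]
      ext i
      by_cases hi : i < m
      · exact (hxe ⟨i, hi⟩).trans (hye ⟨i, hi⟩).symm
      · have h2 := congrFun (congrArg Path.edge h1) i
        rw [splice_edge_of_le _ _ (by omega), splice_edge_of_le _ _ (by omega)] at h2
        exact Subtype.ext h2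
    · exact fun x _ => ⟨n, fun i hi => (splice_edge_of_le e x hi).symm⟩
  · intro g' hg'
    rw [← measure_empty (μ := μ)]
    congr 1
    refine eq_empty_of_forall_notMem fun x ⟨hxe, hx⟩ => hg' (Subtype.ext ?_)
    refine FinPath.eq_of_mem_cylinder (splice_mem_cylinder ?_) (hg _ hx)
    exact (incl_range_eq (refPath_range (B := S.diagram) _) hxe).symm

/-- The part of `S.tailSet n` on which the extension is given by `S.extensionLevel μ n`. -/
abbrev tailLayer (S : B.VertexSubdiagram) (n : ℕ) : Set B.Path :=
  S.tailSet n \ ⋃ m, ⋃ _ : m < n, S.tailSet m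

theorem measurableSet_tailLayer (n : ℕ) : MeasurableSet (S.tailLayer n) :=
  (S.measurableSet_tailSet n).diff
    (MeasurableSet.iUnion fun m => MeasurableSet.iUnion fun _ => S.measurableSet_tailSet m)

theorem disjoint_tailLayer : Pairwise (Function.onFun Disjoint S.tailLayer) := by
  refine (pairwise_disjoint_on _).2 fun m n hmn => disjoint_left.2 fun x hx hx' => hx'.2 ?_
  exact mem_iUnion₂.2 ⟨m, hmn, hx.1⟩

theorem iUnion_tailLayer : ⋃ n, S.tailLayer n = ⋃ n, S.tailSet n := by
  classical
  refine Subset.antisymm (iUnion_mono fun n => sdiff_subset) fun x hx => ?_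
  have hx' := mem_iUnion.1 hx
  refine mem_iUnion.2 ⟨Nat.find hx', Nat.find_spec hx', fun h => ?_⟩
  obtain ⟨m, hm, hxm⟩ := mem_iUnion₂.1 h
  exact Nat.find_min hx' hm hxm

theorem extension_apply' {A : Set B.Path} (hA : MeasurableSet A) :
    S.extension μ A = ∑' m, S.extensionLevel μ m (A ∩ S.tailLayer m) := by
  rw [extension, Measure.sum_apply _ hA]
  exact tsum_congr fun m => Measure.restrict_apply hA

/-- Layers up to `n` are covered by `extensionLevel_eq`, and later layers do not meet `tailSet n`.
This recovers the defining property of the extension, for arbitrary `e` and `f` with a common range.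
-/
theorem extension_apply (hμ : IsTailInvariant μ) {n : ℕ} {f : B.FinPath n}
    {e : S.diagram.FinPath n} {w : {v : B.V n // v ∈ S.W n}} (he : e.range = w)
    (hf : f.range = w) {A : Set B.Path} (hA : MeasurableSet A)
    (hAf : A ⊆ f.cylinder) (hAn : A ⊆ S.tailSet n) :
    S.extension μ A = μ {x | x ∈ e.cylinder ∧ splice f (S.incl x) ∈ A} := by
  have hunion : {x | x ∈ e.cylinder ∧ splice f (S.incl x) ∈ A} =
      ⋃ m, {x | x ∈ e.cylinder ∧ splice f (S.incl x) ∈ A ∩ S.tailLayer m} := by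
    refine Subset.antisymm (fun x ⟨hxe, hx⟩ => ?_) (iUnion_subset fun m x hx => ⟨hx.1, hx.2.1⟩)
    have h1 : splice f (S.incl x) ∈ ⋃ m, S.tailLayer m := by
      rw [iUnion_tailLayer]
      exact mem_iUnion.2 ⟨n, hAn hx⟩
    obtain ⟨m, hm⟩ := mem_iUnion.1 h1
    exact mem_iUnion.2 ⟨m, hxe, hx, hm⟩
  rw [extension_apply' hA, hunion, measure_iUnion]
  · refine tsum_congr fun m => ?_
    rcases le_or_gt m n with hmn | hmn
    · exact extensionLevel_eq hμ hmn he hf (hA.inter (measurableSet_tailLayer m))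
        (inter_subset_left.trans hAf) fun x hx => hx.2.1
    · have : A ∩ S.tailLayer m = ∅ := eq_empty_of_forall_notMem fun x hx =>
        hx.2.2 (mem_iUnion₂.2 ⟨n, hmn, hAn hx.1⟩)
      simp [this]
  · intro m k hmk
    exact disjoint_left.2 fun x hx hx' =>
      disjoint_left.1 (disjoint_tailLayer hmk) hx.2.2 hx'.2.2
  · exact fun m => measurableSet_cylinder_splice f e (hA.inter (measurableSet_tailLayer m))

/-- The extension is invariant under the exchange of initial segments. -/
theorem extension_splice (hμ : IsTailInvariant μ) {n : ℕ} {f f' : B.FinPath n}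
    (hff : f.range = f'.range) {C : Set B.Path} (hC : MeasurableSet C)
    (hCf : C ⊆ f'.cylinder) (hCn : C ⊆ S.tailSet n) :
    S.extension μ {x | x ∈ f.cylinder ∧ splice f' x ∈ C} = S.extension μ C := by
  rcases C.eq_empty_or_nonempty with rfl | ⟨c, hc⟩
  · simp
  have hw : f'.range ∈ S.W n := by
    rw [FinPath.range_eq_vertex (hCf hc)]
    exact hCn hc n le_rfl
  obtain ⟨e, he⟩ := exists_finPath (B := S.diagram) (⟨f'.range, hw⟩ : {v : B.V n // v ∈ S.W n})
  have hm : MeasurableSet {x | x ∈ f.cylinder ∧ splice f' x ∈ C} :=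
    f.measurableSet_cylinder.inter (measurable_splice f' hC)
  rw [extension_apply hμ (f := f') he rfl hC hCf hCn,
    extension_apply hμ (f := f) he hff hm fun x hx => hx.1]
  · congr 1
    ext x
    refine and_congr_right fun hx => ?_
    have h1 : splice f (S.incl x) ∈ f.cylinder :=
      splice_mem_cylinder (hff.trans (incl_range_eq he hx).symm)
    have h2 : splice f' (splice f (S.incl x)) = splice f' (S.incl x) :=
      splice_eq (splice_mem_cylinder (incl_range_eq he hx).symm) fun i hi => by
        rw [splice_edge_of_le _ _ hi, splice_edge_of_le _ _ hi]
    simp only [h1, true_and, mem_ofPred_eq, h2]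
  · exact fun x hx => mem_tailSet_of_edge_eq (hCn hx.2) fun i hi => splice_edge_of_le _ _ hi

theorem extension_compl_iUnion_tailSet : S.extension μ (⋃ n, S.tailSet n)ᶜ = 0 := by
  rw [extension_apply' (MeasurableSet.iUnion S.measurableSet_tailSet).compl]
  refine ENNReal.tsum_eq_zero.2 fun m => ?_
  have : (⋃ n, S.tailSet n)ᶜ ∩ S.tailLayer m = ∅ := eq_empty_of_forall_notMem fun x hx =>
    hx.1 (mem_iUnion.2 ⟨m, hx.2.1⟩)
  rw [this, measure_empty]

theorem iUnion_tailSet_subset_saturation : ⋃ n, S.tailSet n ⊆ saturation S.pathSet := by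
  refine iUnion_subset fun n y hy => ?_
  obtain ⟨x, hx, hxy⟩ := exists_mem_pathSet_of_mem_tailSet hy
  exact ⟨x, hx, n, hxy⟩

/-- Supplies the finite total mass needed for Poincaré recurrence and for continuity from above. -/
theorem isFiniteMeasure_extension (h : S.extension μ (saturation S.pathSet) < ⊤) :
    IsFiniteMeasure (S.extension μ) := by
  refine ⟨?_⟩
  rw [← union_compl_self (⋃ n, S.tailSet n)]
  refine (measure_union_le _ _).trans_lt ?_
  rw [extension_compl_iUnion_tailSet, add_zero]
  exact (measure_mono iUnion_tailSet_subset_saturation).trans_lt h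

/-- This is `extension_apply` at level zero, where splicing in the empty path changes nothing. -/
theorem map_incl_eq_restrict_extension (hμ : IsTailInvariant μ) :
    μ.map S.incl = (S.extension μ).restrict S.pathSet := by
  ext A hA
  have hA' : MeasurableSet (A ∩ S.pathSet) := hA.inter measurableSet_pathSet
  let f : B.FinPath 0 := ⟨fun i => i.elim0, fun i h => absurd h (by omega)⟩
  let e : S.diagram.FinPath 0 := ⟨fun i => i.elim0, fun i h => absurd h (by omega)⟩
  rw [Measure.map_apply S.measurable_incl hA, Measure.restrict_apply hA,
    extension_apply hμ (n := 0) (f := f) (e := e) (w := e.range) rfl (B.eq_v₀ _).symm hA'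
      (fun x _ i => i.elim0)]
  · congr 1
    ext x
    have h1 : splice f (S.incl x) = S.incl x := splice_eq (fun i => i.elim0) fun _ _ => rfl
    have h2 : x ∈ e.cylinder := fun i => i.elim0
    simp only [mem_preimage, mem_ofPred_eq, h1, h2, true_and]
    exact ⟨fun h => ⟨h, x, rfl⟩, fun h => h.1⟩
  · rw [← pathSet_eq_tailSet_zero]
    exact inter_subset_right

end VertexSubdiagram

end BratteliDiagram

end

/-! ### The Vershik map: inverse, local form and orbits. -/

noncomputable section

namespace BratteliDiagram

variable {B : BratteliDiagram}

namespace EdgeOrder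

variable (ω : B.EdgeOrder)

/-- The opposite order. -/
def reverse : B.EdgeOrder where
  le n e f := ω.le n f e
  refl := ω.refl
  antisymm n e f h h' := ω.antisymm n e f h' h
  trans n e f g h h' := ω.trans n g f e h' h
  comparable_iff n e f := or_comm.trans (ω.comparable_iff n e f)

variable {ω}

theorem IsSucc.reverse {n : ℕ} {e f : B.E n} (h : ω.IsSucc e f) : ω.reverse.IsSucc f e := by
  refine ⟨⟨h.1.1, h.1.2.symm⟩, fun g hg => ?_⟩
  have hgf : ω.le n g f := hg.1
  change ω.le n g e
  rcases (ω.comparable_iff n g e).2 ((ω.le_range hgf).trans (ω.le_range h.1.1).symm) with h1 | h1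
  · exact h1
  · by_cases hge : e = g
    · exact hge ▸ ω.refl n e
    · exact absurd (ω.antisymm _ _ _ (h.2 g ⟨h1, hge⟩) hgf) hg.2

theorem IsSucc.not_isMinEdge {n : ℕ} {e f : B.E n} (h : ω.IsSucc e f) : ¬ ω.IsMinEdge f :=
  fun h' => h.1.2 (h' e h.1.1)

/-- The inverse of the Vershik map is the Vershik map of the opposite order, so injectivity and
surjectivity onto the non-minimal paths follow from uniqueness and existence of images. -/
theorem VershikRel.reverse {x y : B.Path} (h : ω.VershikRel x y) : ω.reverse.VershikRel y x := by
  obtain ⟨k, h1, -, h3, h4, h5⟩ := h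
  exact ⟨k, h3, h4.not_isMinEdge, h1, h4.reverse, fun i hi => (h5 i hi).symm⟩

theorem VershikRel.notMem_maxPaths {x y : B.Path} (h : ω.VershikRel x y) : x ∉ ω.maxPaths := by
  obtain ⟨k, -, h2, -⟩ := h
  exact fun hx => h2 (hx k)

theorem VershikRel.notMem_minPaths {x y : B.Path} (h : ω.VershikRel x y) : y ∉ ω.minPaths :=
  h.reverse.notMem_maxPaths

theorem VershikRel.right_unique {x y y' : B.Path} (h : ω.VershikRel x y)
    (h' : ω.VershikRel x y') : y = y' := by
  obtain ⟨k, hk⟩ : ∃ k, ¬ ω.IsMaxEdge (x.edge k) := by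
    obtain ⟨k, -, h2, -⟩ := h
    exact ⟨k, h2⟩
  exact Path.ext (funext fun i => ω.vershikRel_edge_eq h h' hk fun _ _ => rfl)

theorem VershikRel.left_unique {x x' y : B.Path} (h : ω.VershikRel x y)
    (h' : ω.VershikRel x' y) : x = x' :=
  h.reverse.right_unique h'.reverse

theorem VershikRel.vershik_eq {x y : B.Path} (h : ω.VershikRel x y) : ω.vershik x = y :=
  (ω.vershik_spec h.notMem_maxPaths).right_unique h

theorem exists_vershikRel_of_notMem_minPaths {y : B.Path} (hy : y ∉ ω.minPaths) :
    ∃ x, ω.VershikRel x y := by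
  obtain ⟨x, hx⟩ := ω.reverse.exists_vershikRel (x := y) hy
  exact ⟨x, hx.reverse⟩

theorem VershikRel.exists_edge_eq {x y : B.Path} (h : ω.VershikRel x y) :
    ∃ n, ∀ i, n ≤ i → x.edge i = y.edge i := by
  obtain ⟨k, -, -, -, -, h5⟩ := h
  exact ⟨k + 1, fun i hi => (h5 i hi).symm⟩

/-- The Vershik map exchanges initial segments. -/
theorem VershikRel.splice {x y : B.Path} (h : ω.VershikRel x y) {n : ℕ}
    (hn : ∀ i, n ≤ i → x.edge i = y.edge i) {y' : B.Path} (hy' : y' ∈ (y.take n).cylinder) :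
    ω.VershikRel (splice (x.take n) y') y' := by
  obtain ⟨k, h1, h2, h3, h4, h5⟩ := h
  -- The edge at `k` really changes, while nothing changes from `n` on.
  have hkn : k < n := by
    by_contra hc
    exact h4.1.2 (hn k (by omega))
  have hr : (x.take n).range = y'.vertex n := by
    rw [FinPath.range_eq_vertex (x.mem_cylinder_take n), ← FinPath.range_eq_vertex hy',
      FinPath.range_eq_vertex (y.mem_cylinder_take n), Path.vertex, Path.vertex, hn n le_rfl]
  have hx : ∀ i, i < n → (BratteliDiagram.splice (x.take n) y').edge i = x.edge i := fun i hi =>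
    splice_mem_cylinder hr ⟨i, hi⟩
  have hy : ∀ i, i < n → y'.edge i = y.edge i := fun i hi => hy' ⟨i, hi⟩
  refine ⟨k, fun i hi => ?_, ?_, fun i hi => ?_, ?_, fun i hi => ?_⟩
  · rw [hx i (by omega)]
    exact h1 i hi
  · rwa [hx k hkn]
  · rw [hy i (by omega)]
    exact h3 i hi
  · rwa [hx k hkn, hy k hkn]
  · by_cases hin : i < n
    · rw [hx i hin, hy i hin, h5 i hi]
    · rw [splice_edge_of_le _ _ (by omega)]

variable (ω)

theorem exists_minPath_of_tail (x : B.Path) (n : ℕ) :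
    ∃ p : B.Path, (∀ i < n, ω.IsMinEdge (p.edge i)) ∧ ∀ i, n ≤ i → p.edge i = x.edge i := by
  obtain ⟨f, hf, hmin⟩ := ω.exists_minFinPath (x.vertex n)
  refine ⟨splice f x, fun i hi => ?_, fun i hi => splice_edge_of_le f x hi⟩
  have := splice_mem_cylinder hf ⟨i, hi⟩
  rw [this]
  exact hmin ⟨i, hi⟩

theorem wellFounded_lt (n : ℕ) : WellFounded fun e f : B.E n => ω.le n e f ∧ e ≠ f := by
  have : IsTrans (B.E n) fun e f => ω.le n e f ∧ e ≠ f :=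
    ⟨fun a b c hab hbc => ⟨ω.trans _ _ _ _ hab.1 hbc.1, by
      rintro rfl
      exact hab.2 (ω.antisymm _ _ _ hab.1 hbc.1)⟩⟩
  have : Std.Irrefl fun e f : B.E n => ω.le n e f ∧ e ≠ f := ⟨fun a h => h.2 rfl⟩
  exact Finite.wellFounded_of_trans_of_irrefl _

/-- The orbit of a path which is minimal up to level `n` goes through all paths with the same
edges from level `n` on. -/
theorem exists_iterate_vershik_eq (n : ℕ) {p x : B.Path}
    (hp : ∀ i < n, ω.IsMinEdge (p.edge i)) (hpx : ∀ i, n ≤ i → p.edge i = x.edge i) :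
    ∃ k, ω.vershik^[k] p = x := by
  induction n generalizing p x with
  | zero => exact ⟨0, Path.ext (funext fun i => hpx i i.zero_le)⟩
  | succ n ih =>
    -- Inner induction on the last free edge `x_n` in the order of the edges with its range.
    obtain ⟨e, he⟩ : ∃ e, x.edge n = e := ⟨_, rfl⟩
    induction e using (ω.wellFounded_lt n).induction generalizing x with
    | _ e ihe =>
    by_cases hmin : ω.IsMinEdge (x.edge n)
    · refine ih (fun i hi => hp i (by omega)) fun i hi => ?_
      rcases hi.eq_or_lt with rfl | hi
      · have hr : B.r n (p.edge n) = B.r n (x.edge n) := by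
          rw [p.compat, x.compat, hpx _ le_rfl]
        rcases (ω.comparable_iff n _ _).2 hr with h | h
        · exact hmin _ h
        · exact (hp n (by omega) _ h).symm
      · exact hpx i hi
    -- The orbit goes from `p` to `y` (smaller edge at level `n`), then in one step to `q`, the
    -- first path with the tail of `x` from `n` on, then to `x` by the outer induction.
    · obtain ⟨q, hq, hqx⟩ := ω.exists_minPath_of_tail x n
      have hqn : ¬ ω.IsMinEdge (q.edge n) := by rwa [hqx n le_rfl]
      obtain ⟨y, hy⟩ := exists_vershikRel_of_notMem_minPaths (ω := ω) (y := q) fun h => hqn (h n)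
      obtain ⟨j, hj⟩ := ih hq hqx
      have hyq := hy.vershik_eq
      obtain ⟨k, -, -, h3, h4, h5⟩ := hy
      obtain rfl : k = n := by
        rcases lt_trichotomy k n with h | h | h
        · exact absurd (hq k h) h4.not_isMinEdge
        · exact h
        · exact absurd (h3 n h) hqn
      have hlt : ω.le k (y.edge k) e ∧ y.edge k ≠ e := by
        rw [← he, ← hqx k le_rfl]
        exact h4.1
      obtain ⟨a, ha⟩ := ihe _ hlt (x := y) (fun i hi => by
        rw [hpx i hi, ← h5 i hi, hqx i (by omega)]) rfl
      refine ⟨j + (a + 1), ?_⟩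
      rw [Function.iterate_add_apply, Function.iterate_succ_apply', ha, hyq, hj]

/-- Of two tail equivalent paths, one lies in the forward orbit of the other. -/
theorem exists_iterate_vershik_eq_or {x z : B.Path} (h : TailEquiv x z) :
    (∃ k, ω.vershik^[k] x = z) ∨ ∃ k, ω.vershik^[k] z = x := by
  obtain ⟨n, hn⟩ := h
  obtain ⟨p, hp, hpx⟩ := ω.exists_minPath_of_tail x n
  obtain ⟨a, rfl⟩ := ω.exists_iterate_vershik_eq n hp hpx
  obtain ⟨b, rfl⟩ := ω.exists_iterate_vershik_eq n hp fun i hi => (hpx i hi).trans (hn i hi)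
  rcases le_total a b with hab | hab
  · exact Or.inl ⟨b - a, by rw [← Function.iterate_add_apply, Nat.sub_add_cancel hab]⟩
  · exact Or.inr ⟨a - b, by rw [← Function.iterate_add_apply, Nat.sub_add_cancel hab]⟩

/-! ### Invariance of the extension under the Vershik map. -/

variable {ω} {S : B.VertexSubdiagram} {μ : Measure S.diagram.Path}

/-- Outside the maximal paths, where `vershik` has only a placeholder value, the preimage of `C` is
exactly `C` with the segment `f'` exchanged for `f`. -/
theorem extension_vershik_preimage (hμ : IsTailInvariant μ) (hmax : S.extension μ ω.maxPaths = 0)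
    {n : ℕ} {f f' : B.FinPath n} (hff : f.range = f'.range)
    (h : ∀ y ∈ f'.cylinder, ω.VershikRel (splice f y) y) {C : Set B.Path} (hC : MeasurableSet C)
    (hCf : C ⊆ f'.cylinder) (hCn : C ⊆ S.tailSet n) :
    S.extension μ (ω.vershik ⁻¹' C) = S.extension μ C := by
  rw [← measure_sdiff_null' (measure_mono_null inter_subset_right hmax), ← VertexSubdiagram.extension_splice hμ hff hC hCf hCn]
  congr 1
  ext x
  constructor
  · rintro ⟨hxC, hx⟩
    have hy := ω.vershik_spec hx
    have hxy : splice f (ω.vershik x) = x := (h _ (hCf hxC)).left_unique hy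
    have h1 : splice f' x = ω.vershik x := splice_eq (hCf hxC) fun i hi => by
      conv_rhs => rw [← hxy]
      exact (splice_edge_of_le _ _ hi).symm
    refine ⟨?_, by rw [h1]; exact hxC⟩
    rw [← hxy]
    exact splice_mem_cylinder (hff.trans (FinPath.range_eq_vertex (hCf hxC)))
  · rintro ⟨hxf, hxC⟩
    have h1 : splice f (splice f' x) = x :=
      splice_eq hxf fun i hi => (splice_edge_of_le _ _ hi).symm
    have h2 := h _ (hCf hxC)
    rw [h1] at h2
    exact ⟨by rw [mem_preimage, h2.vershik_eq]; exact hxC, h2.notMem_maxPaths⟩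

theorem measurePreserving_vershik (hμ : IsTailInvariant μ)
    (hmax : S.extension μ ω.maxPaths = 0) (hmin : S.extension μ ω.minPaths = 0) :
    MeasurePreserving ω.vershik (S.extension μ) (S.extension μ) := by
  refine ⟨ω.measurable_vershik, ?_⟩
  -- A countable family of local exchanges. Its pieces `P i` carry both measures, so it suffices to
  -- compare these on each piece.
  let ι := {i : Σ n, B.FinPath n × B.FinPath n // i.2.1.range = i.2.2.range ∧
    ∀ y ∈ i.2.2.cylinder, ω.VershikRel (splice i.2.1 y) y}
  let P : ι → Set B.Path := fun i => i.1.2.2.cylinder ∩ S.tailSet i.1.1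
  have hP : ∀ i, MeasurableSet (P i) := fun i =>
    i.1.2.2.measurableSet_cylinder.inter (S.measurableSet_tailSet _)
  have hmem : ∀ {x y : B.Path} {m : ℕ}, ω.VershikRel x y → x ∈ S.tailSet m ∨ y ∈ S.tailSet m →
      y ∈ ⋃ i, P i := by
    intro x y m hxy hm
    obtain ⟨n, hn⟩ := hxy.exists_edge_eq
    have hn' : ∀ i, max m n ≤ i → x.edge i = y.edge i := fun i hi =>
      hn i ((le_max_right _ _).trans hi)
    refine mem_iUnion.2 ⟨⟨⟨max m n, x.take _, y.take _⟩, ?_, fun y' hy' => hxy.splice hn' hy'⟩,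
      y.mem_cylinder_take _, ?_⟩
    · rw [FinPath.range_eq_vertex (x.mem_cylinder_take _),
        FinPath.range_eq_vertex (y.mem_cylinder_take _), Path.vertex, Path.vertex, hn' _ le_rfl]
    · rcases hm with hm | hm
      · exact VertexSubdiagram.mem_tailSet_of_edge_eq (S.tailSet_mono (le_max_left m n) hm) hn'
      · exact S.tailSet_mono (le_max_left m n) hm
  have htail : ∀ᵐ x ∂S.extension μ, x ∈ ⋃ n, S.tailSet n :=
    VertexSubdiagram.extension_compl_iUnion_tailSet
  have hae : ∀ᵐ y ∂S.extension μ, y ∈ ⋃ i, P i := by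
    filter_upwards [htail, measure_eq_zero_iff_ae_notMem.1 hmin] with y hy hy'
    obtain ⟨m, hm⟩ := mem_iUnion.1 hy
    obtain ⟨x, hx⟩ := exists_vershikRel_of_notMem_minPaths hy'
    exact hmem hx (Or.inr hm)
  have hae' : ∀ᵐ y ∂(S.extension μ).map ω.vershik, y ∈ ⋃ i, P i := by
    refine (ae_map_iff (p := fun y => y ∈ ⋃ i, P i) ω.measurable_vershik.aemeasurable
      (MeasurableSet.iUnion hP)).2 ?_
    filter_upwards [htail, measure_eq_zero_iff_ae_notMem.1 hmax] with x hx hx'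
    obtain ⟨m, hm⟩ := mem_iUnion.1 hx
    exact hmem (ω.vershik_spec hx') (Or.inl hm)
  refine (Measure.restrict_eq_self_of_ae_mem hae').symm.trans
    (Eq.trans (Measure.restrict_iUnion_congr.2 fun i => ?_)
      (Measure.restrict_eq_self_of_ae_mem hae))
  ext C hC
  rw [Measure.restrict_apply hC, Measure.restrict_apply hC,
    Measure.map_apply ω.measurable_vershik (hC.inter (hP i))]
  exact extension_vershik_preimage hμ hmax i.2.1 i.2.2 (hC.inter (hP i))
    (fun x hx => hx.2.1) fun x hx => hx.2.2

/-- The saturation of a null set is null. -/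
theorem extension_saturation_null (hμ : IsTailInvariant μ) {N : Set B.Path}
    (hN : MeasurableSet N) (hNS : N ⊆ S.pathSet) (h0 : S.extension μ N = 0) :
    S.extension μ (saturation N) = 0 := by
  let ι := {i : Σ n, B.FinPath n × B.FinPath n // i.2.1.range = i.2.2.range}
  refine measure_mono_null (t := ⋃ i : ι, {y | y ∈ i.1.2.1.cylinder ∧
    splice i.1.2.2 y ∈ N ∩ i.1.2.2.cylinder}) ?_ (measure_iUnion_null fun i => ?_)
  · rintro y ⟨x, hx, n, hn⟩
    refine mem_iUnion.2 ⟨⟨⟨n, y.take n, x.take n⟩, ?_⟩, y.mem_cylinder_take n, ?_⟩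
    · rw [FinPath.range_eq_vertex (x.mem_cylinder_take _),
        FinPath.range_eq_vertex (y.mem_cylinder_take _), Path.vertex, Path.vertex, hn _ le_rfl]
    · have : splice (x.take n) y = x := splice_eq (x.mem_cylinder_take n) hn
      simp only [this]
      exact ⟨hx, x.mem_cylinder_take n⟩
  · rw [VertexSubdiagram.extension_splice hμ i.2 (hN.inter (FinPath.measurableSet_cylinder _))
      inter_subset_right]
    · exact measure_mono_null inter_subset_left h0
    · intro x hx
      have := hNS hx.1
      rw [VertexSubdiagram.pathSet_eq_tailSet_zero] at this
      exact S.tailSet_mono (Nat.zero_le _) this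

end EdgeOrder

end BratteliDiagram

end

/-! ### The skyscraper formula for a finite invariant measure. -/

/-- The skyscraper over `s`: if almost every orbit visits `s`, then the measure is the sum of the
measures of the images of the floors under the first return to `s`. -/
theorem MeasureTheory.MeasurePreserving.measure_eq_tsum_of_ae_hits {α : Type*}
    [MeasurableSpace α] {ν : Measure α} [IsFiniteMeasure ν] {T : α → α}
    (hT : MeasurePreserving T ν ν) {s : Set α} (hs : MeasurableSet s)
    (hhit : ν {x | ∀ j, T^[j] x ∉ s} = 0) {A : Set α} (hA : MeasurableSet A) :
    ν A = ∑' k, ν (s ∩ {x | (∀ j, 1 ≤ j → j ≤ k → T^[j] x ∉ s) ∧ T^[k] x ∈ A}) := by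
  have hTj : ∀ j, Measurable T^[j] := fun j => hT.measurable.iterate j
  have hU : ∀ k, MeasurableSet {x | ∀ j, 1 ≤ j → j ≤ k → T^[j] x ∉ s} := fun k => by
    simp only [ofPred_forall]
    exact MeasurableSet.iInter fun j => MeasurableSet.iInter fun _ => MeasurableSet.iInter fun _ =>
      (hTj j hs).compl
  have hH : ∀ k, MeasurableSet {x | (∀ j, 1 ≤ j → j ≤ k → T^[j] x ∉ s) ∧ T^[k] x ∈ A} := fun k =>
    (hU k).inter (hTj k hA)
  -- Split the remainder along `s`: the part in `s` is the next summand, and the preimage under `T`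
  -- of the part outside `s` is the next remainder. No inverse of `T` is needed.
  have hstep : ∀ K, ν A = ∑ k ∈ Finset.range K,
      ν (s ∩ {x | (∀ j, 1 ≤ j → j ≤ k → T^[j] x ∉ s) ∧ T^[k] x ∈ A}) +
      ν {x | (∀ j, 1 ≤ j → j ≤ K → T^[j] x ∉ s) ∧ T^[K] x ∈ A} := by
    intro K
    induction K with
    | zero =>
      have : {x | (∀ j, 1 ≤ j → j ≤ 0 → T^[j] x ∉ s) ∧ T^[0] x ∈ A} = A := by
        ext x
        exact ⟨fun h => h.2, fun h => ⟨fun j h1 h2 => by omega, h⟩⟩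
      rw [Finset.range_zero, Finset.sum_empty, zero_add, this]
    | succ K ih =>
      rw [Finset.sum_range_succ, add_assoc, ih]
      congr 1
      rw [← measure_inter_add_sdiff {x | (∀ j, 1 ≤ j → j ≤ K → T^[j] x ∉ s) ∧ T^[K] x ∈ A} hs,
        inter_comm, ← hT.measure_preimage ((hH K).diff hs).nullMeasurableSet]
      congr 2
      ext x
      constructor
      · rintro ⟨⟨h1, h2⟩, h3⟩
        refine ⟨fun j hj hjK => ?_, h2⟩
        rcases hj.eq_or_lt with rfl | hj
        · exact h3
        · obtain ⟨i, rfl⟩ : ∃ i, j = i + 1 := ⟨j - 1, by omega⟩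
          exact h1 i (by omega) (by omega)
      · rintro ⟨h1, h2⟩
        exact ⟨⟨fun j hj hjK => h1 (j + 1) (by omega) (by omega), h2⟩, h1 1 le_rfl (by omega)⟩
  have hzero : Filter.Tendsto
      (fun K => ν {x | (∀ j, 1 ≤ j → j ≤ K → T^[j] x ∉ s) ∧ T^[K] x ∈ A})
      Filter.atTop (nhds 0) := by
    -- Times start at `1` here and at `0` in `hhit`, hence the preimage under `T`.
    have h1 : ν (⋂ K, {x | ∀ j, 1 ≤ j → j ≤ K → T^[j] x ∉ s}) = 0 := by
      have : (⋂ K, {x | ∀ j, 1 ≤ j → j ≤ K → T^[j] x ∉ s}) ⊆ T ⁻¹' {x | ∀ j, T^[j] x ∉ s} :=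
        fun x hx j => mem_iInter.1 hx (j + 1) (j + 1) (by omega) le_rfl
      exact measure_mono_null this (hT.quasiMeasurePreserving.preimage_null hhit)
    rw [← h1]
    have h2 := tendsto_measure_iInter_atTop (μ := ν) (fun K => (hU K).nullMeasurableSet)
      (fun K L hKL x hx j hj hjK => hx j hj (hjK.trans hKL)) ⟨0, measure_ne_top _ _⟩
    rw [h1] at h2 ⊢
    exact tendsto_of_tendsto_of_tendsto_of_le_of_le tendsto_const_nhds h2 (fun _ => zero_le)
      fun K => measure_mono fun x hx => hx.1
  have h1 := (ENNReal.tendsto_nat_tsum fun k =>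
    ν (s ∩ {x | (∀ j, 1 ≤ j → j ≤ k → T^[j] x ∉ s) ∧ T^[k] x ∈ A})).add hzero
  rw [add_zero] at h1
  exact tendsto_nhds_unique (tendsto_const_nhds.congr hstep) h1

/-! ### Visits and return times to the subdiagram. -/

noncomputable section

namespace BratteliDiagram

namespace EdgeOrder

variable {B : BratteliDiagram} {ω : B.EdgeOrder} {S : B.VertexSubdiagram}
  {μ : Measure S.diagram.Path}

/-- Almost every orbit of the Vershik map visits the path space of the subdiagram. -/
theorem extension_never_hits_eq_zero (hμ : IsTailInvariant μ) [IsFiniteMeasure (S.extension μ)]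
    (hT : MeasurePreserving ω.vershik (S.extension μ) (S.extension μ)) :
    S.extension μ {x | ∀ j, ω.vershik^[j] x ∉ S.pathSet} = 0 := by
  have hs := VertexSubdiagram.measurableSet_pathSet (S := S)
  -- The points of the subdiagram with finitely many returns, null by Poincaré recurrence.
  let N : Set B.Path := ⋃ n, {x | x ∈ S.pathSet ∧ ∀ m ≥ n, ω.vershik^[m] x ∉ S.pathSet}
  have hN : MeasurableSet N := MeasurableSet.iUnion fun n => by
    have : {x | x ∈ S.pathSet ∧ ∀ m ≥ n, ω.vershik^[m] x ∉ S.pathSet} =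
        S.pathSet ∩ ⋂ m, ⋂ _ : m ≥ n, (ω.vershik^[m] ⁻¹' S.pathSet)ᶜ := by
      ext x
      simp
    rw [this]
    exact hs.inter (MeasurableSet.iInter fun m => MeasurableSet.iInter fun _ =>
      (ω.measurable_vershik.iterate m hs).compl)
  have hN0 : S.extension μ N = 0 := measure_iUnion_null fun n =>
    hT.conservative.measure_mem_forall_ge_image_notMem_eq_zero hs.nullMeasurableSet n
  have hNS : N ⊆ S.pathSet := iUnion_subset fun n x hx => hx.1
  refine measure_mono_null (t := (⋃ n, S.tailSet n)ᶜ ∪ saturation N) (fun x hx => ?_)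
    (measure_union_null VertexSubdiagram.extension_compl_iUnion_tailSet
      (extension_saturation_null hμ hN hNS hN0))
  by_cases hxt : x ∈ ⋃ n, S.tailSet n
  · obtain ⟨n, hn⟩ := mem_iUnion.1 hxt
    obtain ⟨z, hz, hzx⟩ := VertexSubdiagram.exists_mem_pathSet_of_mem_tailSet hn
    refine Or.inr ⟨z, ?_, n, hzx⟩
    rcases ω.exists_iterate_vershik_eq_or ⟨n, hzx⟩ with ⟨k, rfl⟩ | ⟨k, rfl⟩
    · refine mem_iUnion.2 ⟨k, hz, fun m hm => ?_⟩
      have := hx (m - k)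
      rwa [← Function.iterate_add_apply, Nat.sub_add_cancel hm] at this
    · exact absurd hz (hx k)
  · exact Or.inl hxt

/-- Existence of a return is essential: the infimum of the empty set is `0`. -/
theorem lt_firstReturn_iff {x : B.Path} (hx : ∃ n, ω.IsReturnTime S x n) {k : ℕ} :
    k < ω.firstReturn S x ↔ ∀ j, j ≤ k → ¬ ω.IsReturnTime S x j := by
  constructor
  · exact fun h j hj => Nat.notMem_of_lt_sInf (hj.trans_lt h)
  · exact fun h => lt_of_not_ge fun hk => h _ hk (Nat.sInf_mem hx)

/-- The condition on minimal paths is automatic, since images under the Vershik map are never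
minimal. -/
theorem isReturnTime_iff {x : B.Path} (hx : ∀ j, ω.vershik^[j] x ∉ ω.maxPaths) {n : ℕ} :
    ω.IsReturnTime S x n ↔ 1 ≤ n ∧ ω.vershik^[n] x ∈ S.pathSet := by
  refine ⟨fun h => ⟨h.1, h.2.2.1⟩, fun h => ⟨h.1, fun j _ => hx j, h.2, ?_⟩⟩
  obtain ⟨m, rfl⟩ : ∃ m, n = m + 1 := ⟨n - 1, by omega⟩
  rw [Function.iterate_succ_apply']
  exact (ω.vershik_spec (hx m)).notMem_minPaths

end EdgeOrder

end BratteliDiagram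

end

theorem mainTheorem10 (B : BratteliDiagram) (S : B.VertexSubdiagram)
    (μ : MeasureTheory.Measure S.diagram.Path) (hfin : MeasureTheory.IsFiniteMeasure μ)
    (herg : BratteliDiagram.IsErgodic μ)
    (hext : S.extension μ (BratteliDiagram.saturation S.pathSet) < ⊤)
    (hpos : ∀ (n : ℕ) (v : B.V (n + 1)) (w : B.V n), 1 ≤ B.incidence n v w)
    (ω : B.EdgeOrder)
    (hmax : S.extension μ ω.maxPaths = 0)
    (hmin : S.extension μ ω.minPaths = 0) :
    (∀ᵐ x ∂μ, ∃ n, ω.IsReturnTime S (S.incl x) n) ∧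
      ω.returnMeasure S μ = S.extension μ := by
  have hμ := herg.invariant
  have := BratteliDiagram.VertexSubdiagram.isFiniteMeasure_extension hext
  have hT := BratteliDiagram.EdgeOrder.measurePreserving_vershik hμ hmax hmin
  have hs := BratteliDiagram.VertexSubdiagram.measurableSet_pathSet (S := S)
  have hincl := BratteliDiagram.VertexSubdiagram.map_incl_eq_restrict_extension hμ
  have hrange : ∀ x, S.incl x ∈ S.pathSet := fun x => ⟨x, rfl⟩
  have hlift : ∀ {p : B.Path → Prop}, (∀ᵐ x ∂S.extension μ, p x) → ∀ᵐ x ∂μ, p (S.incl x) :=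
    fun hp => ae_of_ae_map S.measurable_incl.aemeasurable (by
      rw [hincl]
      exact ae_restrict_of_ae hp)
  have hreg : ∀ᵐ x ∂μ, ∀ j, ω.vershik^[j] (S.incl x) ∉ ω.maxPaths := by
    have h : ∀ᵐ x ∂S.extension μ, ∀ j, ω.vershik^[j] x ∉ ω.maxPaths := by
      rw [ae_all_iff]
      intro j
      have h0 := (hT.iterate j).quasiMeasurePreserving.preimage_null hmax
      exact measure_eq_zero_iff_ae_notMem.1 h0
    exact hlift h
  have hrec : ∀ᵐ x ∂μ, ∃ n, ω.IsReturnTime S (S.incl x) n := by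
    filter_upwards [hreg, hlift (hT.conservative.ae_mem_imp_frequently_image_mem
      hs.nullMeasurableSet)] with x hx hx'
    obtain ⟨n, hn, hn'⟩ := Filter.frequently_atTop.1 (hx' (hrange x)) 1
    exact ⟨n, (BratteliDiagram.EdgeOrder.isReturnTime_iff hx).2 ⟨hn, hn'⟩⟩
  refine ⟨hrec, Measure.ext fun A hA => ?_⟩
  rw [hT.measure_eq_tsum_of_ae_hits hs
    (BratteliDiagram.EdgeOrder.extension_never_hits_eq_zero hμ hT) hA,
    BratteliDiagram.EdgeOrder.returnMeasure, Measure.sum_apply _ hA]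
  refine tsum_congr fun k => ?_
  have hTk : ∀ j, Measurable ω.vershik^[j] := fun j => ω.measurable_vershik.iterate j
  have hm : Measurable fun x => ω.vershik^[k] (S.incl x) := (hTk k).comp S.measurable_incl
  have hF : MeasurableSet {x | (∀ j, 1 ≤ j → j ≤ k → ω.vershik^[j] x ∉ S.pathSet) ∧
      ω.vershik^[k] x ∈ A} := by
    rw [ofPred_and]
    refine MeasurableSet.inter ?_ (hTk k hA)
    simp only [ofPred_forall]
    exact MeasurableSet.iInter fun j => MeasurableSet.iInter fun _ => MeasurableSet.iInter fun _ =>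
      (hTk j hs).compl
  rw [Measure.map_apply hm hA, Measure.restrict_apply (hm hA), inter_comm S.pathSet,
    ← Measure.restrict_apply hF, ← hincl, Measure.map_apply S.measurable_incl hF]
  refine measure_congr ?_
  filter_upwards [hreg, hrec] with x hx hx'
  refine propext ?_
  have h1 : k < ω.firstReturn S (S.incl x) ↔
      ∀ j, 1 ≤ j → j ≤ k → ω.vershik^[j] (S.incl x) ∉ S.pathSet := by
    rw [BratteliDiagram.EdgeOrder.lt_firstReturn_iff hx']
    simp only [BratteliDiagram.EdgeOrder.isReturnTime_iff hx]
    exact ⟨fun h j hj hjk hmem => h j hjk ⟨hj, hmem⟩, fun h j hjk hmem => h j hmem.1 hjk hmem.2⟩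
  exact and_comm.trans (and_congr_left fun _ => h1)
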